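/- A real polynomial $f$ is called Hurwitz stable if it is identically zero or $f(z)\neq0$ for all $z\in\mathbb{C}$ with $\operatorname{Re} z>0$; a polynomial $f=\sum_{k=0}^{d}f_kx^k$ of degree $d$ is called symmetric if $f_k=f_{d-k}$ for $0\le k\le d$; and $f$ is called semi-$\gamma$-positive if there are $\varepsilon\in\{0,1\}$, $N\in\mathbb{N}$ and real numbers $g_0,\dots,g_N\ge0$ with $$f(x)=(1+x)^{\varepsilon}\sum_{k=0}^{N}g_kx^k(1+x^2)^{N-k}.$$ **Theorem.** Let $(\beta_n)_{n\ge0}$, $(\mu_n)_{n\ge0}$, $(\nu_n)_{n\ge0}$ be real sequences with $\mu_n\le0\le\nu_n$ for all $n$, and let $(T_n(x))_{n\ge0}$ be a sequence of real polynomials such that, with $m_n=\deg T_n$, one has $m_{n+1}=m_n+1$ and $$T_{n+1}(x)=\left(-m_n\mu_nx^2+\beta_nx+\beta_n+m_n\nu_n\right)T_n(x)+\left(\mu_nx^3+\nu_nx^2-\nu_nx-\mu_n\right)T_n'(x)$$ for all $n\ge0$. Assume that $\mu_n+\nu_n\le0$ and $2\beta_n+m_n(\mu_n+\nu_n)\ge0$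 for all $n\ge0$, and that $T_0$ is Hurwitz stable. Then $T_n$ is Hurwitz stable for every $n\ge0$. If moreover $T_0$ is symmetric and has positive leading coefficient, then $T_n$ is semi-$\gamma$-positive for every $n\ge0$. -/

import Mathlib

open Polynomial

/-- A real polynomial, viewed as a complex one, is Hurwitz stable if it is identically zero or
has no zero in the open right half-plane. -/
def IsHurwitzStable (f : ℝ[X]) : Prop :=
  f = 0 ∨ ∀ z : ℂ, 0 < z.re → aeval z f ≠ 0

/-- `f = ∑_{k=0}^d f_k x^k` of degree `d` is symmetric if `f_k = f_{d-k}` for `0 ≤ k ≤ d`. -/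
def IsSymmetricPoly (f : ℝ[X]) : Prop :=
  ∀ k ≤ f.natDegree, f.coeff k = f.coeff (f.natDegree - k)

/-- `f = (1+x)^ε ∑_{k=0}^N g_k x^k (1+x^2)^{N-k}` with `ε ∈ {0,1}` and all `g_k ≥ 0`. -/
def IsSemiGammaPositive (f : ℝ[X]) : Prop :=
  ∃ (ε N : ℕ) (g : ℕ → ℝ), (ε = 0 ∨ ε = 1) ∧ (∀ k ≤ N, 0 ≤ g k) ∧
    f = (1 + X) ^ ε * ∑ k ∈ Finset.range (N + 1), C (g k) * X ^ k * (1 + X ^ 2) ^ (N - k)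

/-! ### Preservation of Hurwitz stability -/

/-! For `f` stable of degree `d ≥ 1`, set `H = d z + (1 - z²) f'/f`; summing over the roots shows
`Re H > 0` when `Re z > 0`. The recurrence divided by `(1 + z) f` becomes `b + q H + a κ (d + H)`
with `κ = (1 + z²)/(1 + z)²` and `a, b, q ≥ 0`, which vanishes only if `a = b = q = 0`, and then the
new polynomial is zero.

For semi-γ-positivity, the recurrence preserves `f(x) = x^d f(1/x)`. After removing a factor `1 + x`
if `d` is odd, `f(x) = x^N p(x + 1/x)`, where the coefficients of `p` are the `g_k`. Stability
passes from `f` to `p`, so the coefficients of `p` share one sign, which `p(2) = f(1) > 0` fixes. -/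

lemma re_mobius_pos {z r : ℂ} (hz : 0 < z.re) (hr : r.re ≤ 0) :
    0 < (z + (1 - z ^ 2) * (1 / (z - r))).re := by
  have hne : z - r ≠ 0 := fun h => by
    have := congrArg Complex.re h
    simp at this
    linarith
  have h1 : z + (1 - z ^ 2) * (1 / (z - r)) = (1 - r * z) / (z - r) := by
    field_simp
    ring
  rw [h1, Complex.div_re, ← add_div]
  refine div_pos ?_ (Complex.normSq_pos.2 hne)
  have h2 : (1 - r * z).re * (z - r).re + (1 - r * z).im * (z - r).im
      = z.re + (-r.re) + (r.re ^ 2 + r.im ^ 2) * z.re + (z.re ^ 2 + z.im ^ 2) * (-r.re) := by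
    simp
    ring
  rw [h2]
  have h3 : 0 ≤ -r.re := by linarith
  positivity

lemma re_sum_mobius_pos {z : ℂ} (hz : 0 < z.re) (s : Multiset ℂ) (hs : ∀ r ∈ s, r.re ≤ 0)
    (h0 : s ≠ 0) :
    0 < ((s.card : ℂ) * z + (1 - z ^ 2) * (s.map fun r => 1 / (z - r)).sum).re := by
  induction s using Multiset.induction with
  | empty => exact absurd rfl h0
  | cons r s ih =>
    have h1 := re_mobius_pos hz (hs r (Multiset.mem_cons_self r s))
    have h2 : 0 ≤ ((s.card : ℂ) * z + (1 - z ^ 2) * (s.map fun r => 1 / (z - r)).sum).re := by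
      by_cases hs0 : s = 0
      · simp [hs0]
      · exact (ih (fun r hr => hs r (Multiset.mem_cons_of_mem hr)) hs0).le
    have h3 : (((r ::ₘ s).card : ℂ) * z
        + (1 - z ^ 2) * ((r ::ₘ s).map fun r => 1 / (z - r)).sum)
        = (z + (1 - z ^ 2) * (1 / (z - r)))
          + ((s.card : ℂ) * z + (1 - z ^ 2) * (s.map fun r => 1 / (z - r)).sum) := by
      rw [Multiset.card_cons, Multiset.map_cons, Multiset.sum_cons]
      push_cast
      ring
    rw [h3, Complex.add_re]
    linarith

lemma re_logDeriv_pos {f : ℝ[X]} (hf : ∀ z : ℂ, 0 < z.re → aeval z f ≠ 0)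
    (hd : f.natDegree ≠ 0) {z : ℂ} (hz : 0 < z.re) :
    0 < ((f.natDegree : ℂ) * z
      + (1 - z ^ 2) * (aeval z (derivative f) / aeval z f)).re := by
  set p : ℂ[X] := f.map (algebraMap ℝ ℂ) with hp
  have hsp : p.Splits := IsAlgClosed.splits p
  have hev : ∀ w, p.eval w = aeval w f := fun w => by
    rw [hp, eval_map_algebraMap]
  have hev' : p.derivative.eval z = aeval z (derivative f) := by
    rw [hp, derivative_map, eval_map_algebraMap]
  have hcard : p.roots.card = f.natDegree := by
    rw [← hsp.natDegree_eq_card_roots, hp, natDegree_map]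
  have h := hsp.eval_derivative_div_eval_of_ne_zero (x := z) (by rw [hev]; exact hf z hz)
  rw [hev, hev'] at h
  rw [h, ← hcard]
  refine re_sum_mobius_pos hz _ (fun r hr => ?_) (fun h0 => hd ?_)
  · by_contra! hr'
    exact hf r hr' (by rw [← hev]; exact (mem_roots'.1 hr).2)
  · rw [← hcard, h0, Multiset.card_zero]

/-- The reciprocal is `1 + 2/(z + z⁻¹)` where `z² ≠ -1`, and `z + z⁻¹` stays in the right
half-plane. -/
lemma re_one_add_sq_div_pos {z : ℂ} (hz : 0 < z.re) :
    0 < ((1 + z ^ 2) / (1 + z) ^ 2).re := by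
  have hne : (1 + z) ^ 2 ≠ 0 := pow_ne_zero _ fun h => by
    have := congrArg Complex.re h
    simp at this
    linarith
  rw [Complex.div_re, ← add_div]
  refine div_pos ?_ (Complex.normSq_pos.2 hne)
  have h : (1 + z ^ 2).re * ((1 + z) ^ 2).re + (1 + z ^ 2).im * ((1 + z) ^ 2).im
      = (z.im ^ 2 - 1) ^ 2 + (2 * z.re + 2 * z.re ^ 2 + 2 * z.re ^ 3 + z.re ^ 4)
        + z.im ^ 2 * (2 * z.re ^ 2 + 2 * z.re) := by
    simp [pow_two]
    ring
  rw [h]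
  positivity

/-- Dividing by `d + H` leaves `b/(d + H) + q H/(d + H) + a κ`, where `1/(d + H)`, `H/(d + H)` and
`κ` all have positive real part. The proof multiplies by the conjugate of `d + H` instead. -/
lemma coeffs_eq_zero_of_re_pos {κ H : ℂ} {d a b q : ℝ} (hκ : 0 < κ.re) (hH : 0 < H.re)
    (hd : 0 ≤ d) (ha : 0 ≤ a) (hb : 0 ≤ b) (hq : 0 ≤ q)
    (h : (b : ℂ) + q * H + a * κ * (d + H) = 0) : a = 0 ∧ b = 0 ∧ q = 0 := by
  have e1 := congrArg Complex.re h
  have e2 := congrArg Complex.im h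
  simp at e1 e2
  have e : b * (d + H.re) + q * (H.re * (d + H.re) + H.im ^ 2)
      + a * (κ.re * ((d + H.re) ^ 2 + H.im ^ 2)) = 0 := by
    linear_combination (d + H.re) * e1 + H.im * e2
  have hB : 0 < d + H.re := by linarith
  have hQ : 0 < H.re * (d + H.re) + H.im ^ 2 := by positivity
  have hA : 0 < κ.re * ((d + H.re) ^ 2 + H.im ^ 2) := by positivity
  have tb := mul_nonneg hb hB.le
  have tq := mul_nonneg hq hQ.le
  have ta := mul_nonneg ha hA.le
  exact ⟨(mul_eq_zero.1 (by linarith : a * _ = 0)).resolve_right hA.ne',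
    (mul_eq_zero.1 (by linarith : b * _ = 0)).resolve_right hB.ne',
    (mul_eq_zero.1 (by linarith : q * _ = 0)).resolve_right hQ.ne'⟩

/-- The right-hand side of the recurrence. -/
noncomputable def recStep (β μ ν : ℝ) (f : ℝ[X]) : ℝ[X] :=
  (C (-(f.natDegree : ℝ) * μ) * X ^ 2 + C β * X + C (β + (f.natDegree : ℝ) * ν)) * f
    + (C μ * X ^ 3 + C ν * X ^ 2 - C ν * X - C μ) * derivative f

lemma recStep_stable {β μ ν : ℝ} {f : ℝ[X]} (hμ : μ ≤ 0) (hν : 0 ≤ ν) (hμν : μ + ν ≤ 0)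
    (hβ : 0 ≤ 2 * β + (f.natDegree : ℝ) * (μ + ν)) (h0 : recStep β μ ν f ≠ 0)
    (hf : ∀ z : ℂ, 0 < z.re → aeval z f ≠ 0) :
    ∀ z : ℂ, 0 < z.re → aeval z (recStep β μ ν f) ≠ 0 := by
  intro z hz hF
  have hfz := hf z hz
  have hz1 : 1 + z ≠ 0 := fun h => by
    have := congrArg Complex.re h
    simp at this
    linarith
  by_cases hd : f.natDegree = 0
  · obtain ⟨c, rfl⟩ := natDegree_eq_zero.1 hd
    simp [recStep] at hF h0 hfz
    rcases hF with hF | hF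
    · have : (β : ℂ) * (1 + z) = 0 := by linear_combination hF
      have hβ0 : β = 0 := by simpa [hz1] using this
      simp [hβ0] at h0
    · exact hfz hF
  · have hH := re_logDeriv_pos hf hd hz
    set d : ℝ := (f.natDegree : ℝ) with hddef
    have hdC : (f.natDegree : ℂ) = (d : ℂ) := by simp [hddef]
    rw [hdC] at hH
    set L : ℂ := aeval z (derivative f) / aeval z f with hL
    set H : ℂ := (d : ℂ) * z + (1 - z ^ 2) * L with hHdef
    have hLf : aeval z (derivative f) = L * aeval z f := (div_mul_cancel₀ _ hfz).symm
    have hF' : ((-(d : ℂ) * μ) * z ^ 2 + β * z + (β + d * ν))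
        + (μ * z ^ 3 + ν * z ^ 2 - ν * z - μ) * L = 0 := by
      refine (mul_eq_zero.1 (?_ : _ * aeval z f = 0)).resolve_right hfz
      rw [← hF, recStep]
      simp [hLf, ← hddef]
      simp [hddef]
      ring
    -- The cubic is `(z - 1)(μ z² + (μ + ν) z + μ)`; these weights come from writing `-μ(1 + z²) -
    -- (μ + ν) z` as `a (1 + z²) + q (1 + z)²`.
    obtain ⟨ha, hb, hq⟩ := coeffs_eq_zero_of_re_pos (d := d) (a := (ν - μ) / 2)
      (b := β + d * (μ + ν) / 2) (q := -(μ + ν) / 2) (re_one_add_sq_div_pos hz) hH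
      (Nat.cast_nonneg _) (by linarith) (by linarith) (by linarith) (by
        push_cast
        field_simp
        rw [hHdef]
        linear_combination 2 * (1 + z) * hF')
    have hμ0 : μ = 0 := by linarith
    have hν0 : ν = 0 := by linarith
    have hβ0 : β = 0 := by simpa [hμ0, hν0] using hb
    exact h0 (by simp [recStep, hμ0, hν0, hβ0])

/-! ### Nonnegativity of the coefficients of Hurwitz stable polynomials -/

lemma coeff_mul_nonneg {p q : ℝ[X]} (hp : ∀ k, 0 ≤ p.coeff k) (hq : ∀ k, 0 ≤ q.coeff k) (k : ℕ) :
    0 ≤ (p * q).coeff k := by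
  rw [coeff_mul]
  exact Finset.sum_nonneg fun x _ => mul_nonneg (hp _) (hq _)

lemma coeff_nonneg_of_stable {f : ℝ[X]} (hf : ∀ z : ℂ, 0 < z.re → aeval z f ≠ 0)
    (hlead : 0 < f.leadingCoeff) (k : ℕ) : 0 ≤ f.coeff k := by
  induction hn : f.natDegree using Nat.strong_induction_on generalizing f k with
  | _ n ih =>
  -- Induction on degree: split off `X - r` with `r ≤ 0`, or the quadratic of a conjugate pair with
  -- nonpositive real part.
  have key : ∀ p q : ℝ[X], f = p * q → p.Monic → 0 < p.natDegree → (∀ k, 0 ≤ p.coeff k) →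
      0 ≤ f.coeff k := by
    intro p q hpq hp hpd hpc
    have hq0 : q ≠ 0 := by
      rintro rfl
      simp [hpq] at hlead
    rw [hpq]
    refine coeff_mul_nonneg hpc (fun j => ih q.natDegree ?_ ?_ ?_ j rfl) k
    · rw [← hn, hpq, hp.natDegree_mul' hq0]
      omega
    · intro z hz hqz
      exact hf z hz (by rw [hpq, map_mul, hqz, mul_zero])
    · rwa [hpq, leadingCoeff_mul, hp.leadingCoeff, one_mul] at hlead
  by_cases hd : f.natDegree = 0
  · obtain ⟨c, rfl⟩ := natDegree_eq_zero.1 hd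
    rw [leadingCoeff_C] at hlead
    rw [coeff_C]
    split_ifs <;> linarith
  · obtain ⟨z, hz⟩ := IsAlgClosed.exists_aeval_eq_zero ℂ f
      (fun h => hd (natDegree_eq_zero_iff_degree_le_zero.2 h.le))
    have hzre : z.re ≤ 0 := by
      by_contra! h
      exact hf z h hz
    by_cases him : z.im = 0
    · have hzr : z = algebraMap ℝ ℂ z.re := Complex.ext (by simp) (by simp [him])
      have hroot : f.IsRoot z.re := by
        rw [hzr, aeval_algebraMap_apply] at hz
        simpa [IsRoot] using hz
      obtain ⟨q, hq⟩ := dvd_iff_isRoot.2 hroot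
      refine key _ q hq (monic_X_sub_C _) (by simp) fun j => ?_
      rw [coeff_sub, coeff_X, coeff_C]
      split_ifs <;> linarith
    · obtain ⟨q, hq⟩ := f.quadratic_dvd_of_aeval_eq_zero_im_ne_zero hz him
      have hform : (X ^ 2 - C (2 * z.re) * X + C (‖z‖ ^ 2) : ℝ[X])
          = C 1 * X ^ 2 + C (-(2 * z.re)) * X + C (‖z‖ ^ 2) := by
        simp
        ring
      rw [hform] at hq
      have hnd := natDegree_quadratic (a := (1 : ℝ)) (b := -(2 * z.re)) (c := ‖z‖ ^ 2) one_ne_zero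
      refine key _ q hq ?_ (by rw [hnd]; norm_num) fun j => ?_
      · exact leadingCoeff_quadratic (one_ne_zero)
      · have h1 : 0 ≤ -(2 * z.re) := by linarith
        have h2 : 0 ≤ ‖z‖ ^ 2 := by positivity
        simp only [coeff_add, coeff_C_mul, coeff_X_pow, coeff_X, coeff_C]
        positivity

lemma eval_one_pos_of_stable {f : ℝ[X]} (hf : ∀ z : ℂ, 0 < z.re → aeval z f ≠ 0)
    (hlead : 0 < f.leadingCoeff) : 0 < f.eval 1 := by
  rw [eval_eq_sum_range]
  refine Finset.sum_pos' (fun i _ => by simpa using coeff_nonneg_of_stable hf hlead i)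
    ⟨f.natDegree, by simp, by simpa using hlead⟩

lemma coeff_nonneg_of_stable_of_eval_pos {f : ℝ[X]} (hf : ∀ z : ℂ, 0 < z.re → aeval z f ≠ 0)
    {x : ℝ} (hx : 0 ≤ x) (hev : 0 < f.eval x) (k : ℕ) : 0 ≤ f.coeff k := by
  refine coeff_nonneg_of_stable hf ?_ k
  by_contra! h
  have hf0 : f ≠ 0 := by
    rintro rfl
    simp at hev
  have hneg : 0 < (-f).leadingCoeff := by
    rw [leadingCoeff_neg]
    have := leadingCoeff_ne_zero.2 hf0
    exact neg_pos.2 (lt_of_le_of_ne h this)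
  have hc := coeff_nonneg_of_stable (f := -f) (fun z hz => by simpa using hf z hz) hneg
  have : 0 ≤ (-f).eval x := by
    rw [eval_eq_sum_range]
    exact Finset.sum_nonneg fun i _ => mul_nonneg (hc i) (pow_nonneg hx i)
  rw [eval_neg] at this
  linarith

/-! ### Self-reciprocal polynomials -/

/-- `f(x) = x^d f(1/x)`. -/
def SelfReciprocal (d : ℕ) (f : ℝ[X]) : Prop :=
  ∀ x : ℝ, x ≠ 0 → f.eval x = x ^ d * f.eval x⁻¹

lemma IsSymmetricPoly.selfReciprocal {f : ℝ[X]} (hf : IsSymmetricPoly f) :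
    SelfReciprocal f.natDegree f := by
  have hrev : f.reverse = f := by
    ext k
    rw [coeff_reverse]
    by_cases hk : k ≤ f.natDegree
    · rw [revAt_le hk, hf k hk]
    · rw [revAt_eq_self_of_lt (not_le.1 hk)]
  intro x hx
  have := invertibleOfNonzero hx
  have h := eval₂_reverse_mul_pow (RingHom.id ℝ) x f
  rw [hrev, invOf_eq_inv] at h
  simp only [eval₂_id] at h
  rw [← h, mul_comm]

lemma SelfReciprocal.eval_derivative {d : ℕ} {f : ℝ[X]} (hf : SelfReciprocal d f) {x : ℝ}
    (hx : x ≠ 0) :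
    x * (derivative f).eval x
      = d * (x ^ d * f.eval x⁻¹) - x ^ d * x⁻¹ * (derivative f).eval x⁻¹ := by
  have h1 : HasDerivAt (fun y => f.eval y) ((derivative f).eval x) x := f.hasDerivAt x
  have h2 : HasDerivAt (fun y : ℝ => y ^ d * f.eval y⁻¹)
      ((d * x ^ (d - 1)) * f.eval x⁻¹ + x ^ d * ((derivative f).eval x⁻¹ * (-(x ^ 2)⁻¹))) x :=
    (hasDerivAt_pow d x).mul ((f.hasDerivAt x⁻¹).comp x (hasDerivAt_inv hx))
  have h3 : (fun y => f.eval y) =ᶠ[nhds x] (fun y : ℝ => y ^ d * f.eval y⁻¹) := by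
    filter_upwards [isOpen_ne.mem_nhds hx] with y hy using hf y hy
  rw [(h1.congr_of_eventuallyEq h3.symm).unique h2]
  rcases d with _ | d
  · simp
    field_simp
  · simp only [Nat.add_sub_cancel]
    field_simp
    ring

lemma SelfReciprocal.recStep {β μ ν : ℝ} {f : ℝ[X]} (hf : SelfReciprocal f.natDegree f) :
    SelfReciprocal (f.natDegree + 1) (recStep β μ ν f) := by
  intro x hx
  have h1 := hf x hx
  have h2 := hf.eval_derivative hx
  have h3 : (derivative f).eval x = x⁻¹ * (f.natDegree * (x ^ f.natDegree * f.eval x⁻¹)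
      - x ^ f.natDegree * x⁻¹ * (derivative f).eval x⁻¹) := by
    rw [← h2]
    field_simp
  simp only [_root_.recStep, eval_add, eval_mul, eval_sub, eval_C, eval_X, eval_pow]
  rw [h1, h3, pow_succ]
  field_simp
  ring

/-! ### Gamma expansions and the substitution `y = x + 1/x` -/

lemma SelfReciprocal.exists_gamma {N : ℕ} {f : ℝ[X]} (hf : SelfReciprocal (2 * N) f) :
    ∃ c : ℕ → ℝ,
      f = ∑ k ∈ Finset.range (N + 1), C (c k) * X ^ k * (1 + X ^ 2) ^ (N - k) := by
  induction N generalizing f with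
  | zero =>
    -- Here `f(x) = f(1/x)`; comparing degrees with the reverse forces `f` to be constant.
    have hrev : X ^ f.natDegree * f = f.reverse := by
      refine eq_of_infinite_eval_eq _ _ (Set.Infinite.mono (s := {0}ᶜ) (fun x hx => ?_)
        (Set.finite_singleton _).infinite_compl)
      have hx : x ≠ 0 := hx
      have := invertibleOfNonzero (inv_ne_zero hx)
      have h := eval₂_reverse_mul_pow (RingHom.id ℝ) x⁻¹ f
      simp only [invOf_eq_inv, inv_inv, eval₂_id] at h
      have h' := hf x hx
      simp only [mul_zero, pow_zero, one_mul] at h'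
      simp only [Set.mem_ofPred_eq, eval_mul, eval_pow, eval_X]
      rw [h', ← h, inv_pow]
      field_simp
    have hd : f.natDegree = 0 := by
      by_cases h0 : f = 0
      · simp [h0]
      · have h := congrArg natDegree hrev
        rw [natDegree_X_pow_mul _ h0] at h
        have := f.reverse_natDegree_le
        omega
    obtain ⟨c, rfl⟩ := natDegree_eq_zero.1 hd
    exact ⟨fun _ => c, by simp⟩
  | succ N ih =>
    -- Removing the `k = 0` term leaves `X * h`, with `h` self-reciprocal for the exponent `2 * N`.
    have hdvd : X ∣ f - C (f.coeff 0) * (1 + X ^ 2) ^ (N + 1) := by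
      rw [X_dvd_iff]
      simp [coeff_zero_eq_eval_zero]
    obtain ⟨h, hh⟩ := hdvd
    have hS : SelfReciprocal (2 * N) h := by
      intro x hx
      have e1 := congrArg (eval x) hh
      have e2 := congrArg (eval x⁻¹) hh
      have e3 := hf x hx
      simp only [eval_sub, eval_mul, eval_C, eval_pow, eval_add, eval_one, eval_X] at e1 e2
      have e4 : x ^ (2 * (N + 1)) * (1 + x⁻¹ ^ 2) ^ (N + 1) = (1 + x ^ 2) ^ (N + 1) := by
        rw [pow_mul, ← mul_pow]
        congr 1
        field_simp
        ring
      have e5 : x * h.eval x = x ^ (2 * (N + 1)) * (x⁻¹ * h.eval x⁻¹) := by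
        rw [← e1, ← e2, e3, ← e4]
        ring
      apply mul_left_cancel₀ hx
      rw [e5]
      have : x ^ (2 * (N + 1)) = x ^ (2 * N) * (x * x) := by ring
      rw [this]
      field_simp
    obtain ⟨c, hc⟩ := ih hS
    refine ⟨fun k => Nat.casesOn k (f.coeff 0) c, ?_⟩
    rw [Finset.sum_range_succ']
    refine (sub_eq_iff_eq_add.1 hh).trans ?_
    congr 1
    · nth_rewrite 1 [hc]
      rw [Finset.mul_sum]
      refine Finset.sum_congr rfl fun k _ => ?_
      simp only [Nat.add_sub_add_right]
      ring
    · simp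

lemma SelfReciprocal.exists_gamma_nonneg {N : ℕ} {f : ℝ[X]} (hf : SelfReciprocal (2 * N) f)
    (hst : ∀ z : ℂ, 0 < z.re → aeval z f ≠ 0) (h1 : 0 < f.eval 1) :
    ∃ c : ℕ → ℝ, (∀ k ≤ N, 0 ≤ c k) ∧
      f = ∑ k ∈ Finset.range (N + 1), C (c k) * X ^ k * (1 + X ^ 2) ^ (N - k) := by
  obtain ⟨c, hc⟩ := hf.exists_gamma
  refine ⟨c, fun k hk => ?_, hc⟩
  set p : ℝ[X] := ∑ k ∈ Finset.range (N + 1), C (c k) * X ^ (N - k) with hp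
  have hcoeff : p.coeff (N - k) = c k := by
    rw [hp, finsetSum_coeff, Finset.sum_eq_single k]
    · simp
    · intro j hj hjk
      rw [Finset.mem_range] at hj
      rw [coeff_C_mul_X_pow, if_neg (by omega)]
    · intro h
      exact absurd (Finset.mem_range.2 (by omega)) h
  rw [← hcoeff]
  refine coeff_nonneg_of_stable_of_eval_pos (x := 2) ?_ (by norm_num) ?_ _
  · intro y hy hpy
    -- Solve `z + 1/z = y` by the quadratic formula. As `Re y = Re z (1 + 1/|z|²)`, a root `y` of
    -- `p` with `Re y > 0` yields a root `z` of `f` with `Re z > 0`.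
    obtain ⟨w, hw⟩ := IsAlgClosed.exists_pow_nat_eq (y ^ 2 - 4) (n := 2) (by norm_num)
    set z : ℂ := (y + w) / 2 with hz
    have hzy : z ^ 2 + 1 = y * z := by
      rw [hz]
      linear_combination hw / 4
    have hz0 : z ≠ 0 := by
      intro h
      simp [h] at hzy
    have hyz : y = z + z⁻¹ := by
      field_simp
      linear_combination -hzy
    have hzre : 0 < z.re := by
      have h := hy
      rw [hyz, Complex.add_re, Complex.inv_re] at h
      by_contra! hneg
      have := div_nonpos_of_nonpos_of_nonneg hneg (Complex.normSq_nonneg z)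
      linarith
    refine hst z hzre ?_
    have : aeval z f = z ^ N * aeval y p := by
      rw [hc, hp, map_sum, map_sum, Finset.mul_sum]
      refine Finset.sum_congr rfl fun j hj => ?_
      have hj' : j ≤ N := by
        rw [Finset.mem_range] at hj
        omega
      simp only [map_mul, map_pow, map_add, map_one, aeval_X, aeval_C]
      rw [add_comm 1 (z ^ 2), hzy, mul_pow]
      nth_rewrite 3 [← Nat.sub_add_cancel hj']
      rw [pow_add]
      ring
    rw [this, hpy, mul_zero]
  · have : f.eval 1 = p.eval 2 := by
      rw [hc, hp, eval_finsetSum, eval_finsetSum]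
      refine Finset.sum_congr rfl fun j _ => ?_
      simp
      norm_num
    rwa [← this]

lemma SelfReciprocal.isSemiGammaPositive {d : ℕ} {f : ℝ[X]} (hf : SelfReciprocal d f)
    (hst : ∀ z : ℂ, 0 < z.re → aeval z f ≠ 0) (h1 : 0 < f.eval 1) :
    IsSemiGammaPositive f := by
  obtain ⟨N, rfl | rfl⟩ := Nat.even_or_odd' d
  · obtain ⟨c, hc0, hc⟩ := hf.exists_gamma_nonneg hst h1
    exact ⟨0, N, c, Or.inl rfl, hc0, by rw [pow_zero, one_mul]; exact hc⟩
  · have hroot : f.IsRoot (-1) := by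
      have h := hf (-1) (by norm_num)
      rw [Odd.neg_one_pow ⟨N, rfl⟩, inv_neg, inv_one] at h
      exact (by linarith : f.eval (-1) = 0)
    obtain ⟨h, hh⟩ := dvd_iff_isRoot.2 hroot
    have hh' : f = (1 + X) * h := by
      rw [hh, C_neg, C_1, sub_neg_eq_add, add_comm X 1]
    have hS : SelfReciprocal (2 * N) h := by
      intro x hx
      -- At `x = -1` cancelling `1 + x` is impossible, but `-1` is its own inverse.
      by_cases hx1 : 1 + x = 0
      · have hx1 : x = -1 := by linarith
        rw [hx1, Even.neg_one_pow ⟨N, two_mul N⟩, inv_neg, inv_one, one_mul]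
      · have e := hf x hx
        rw [hh'] at e
        simp only [eval_mul, eval_add, eval_one, eval_X] at e
        apply mul_left_cancel₀ hx1
        rw [e, pow_succ]
        field_simp
        ring
    obtain ⟨c, hc0, hc⟩ := hS.exists_gamma_nonneg
      (fun z hz h0 => hst z hz (by rw [hh', map_mul, h0, mul_zero])) (by
        rw [hh'] at h1
        simp only [eval_mul, eval_add, eval_one, eval_X] at h1
        linarith)
    exact ⟨1, N, c, Or.inr rfl, hc0, by rw [pow_one, ← hc]; exact hh'⟩

theorem mainTheorem6
    (β μ ν : ℕ → ℝ) (m : ℕ → ℕ) (T : ℕ → ℝ[X])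
    (hdeg : ∀ n, (T n).natDegree = m n)
    (hgrow : ∀ n, m (n + 1) = m n + 1)
    (hrec : ∀ n, T (n + 1) =
      (C (-(m n : ℝ) * μ n) * X ^ 2 + C (β n) * X + C (β n + (m n : ℝ) * ν n)) * T n
        + (C (μ n) * X ^ 3 + C (ν n) * X ^ 2 - C (ν n) * X - C (μ n)) * derivative (T n))
    (hμ : ∀ n, μ n ≤ 0) (hν : ∀ n, 0 ≤ ν n)
    (hμν : ∀ n, μ n + ν n ≤ 0)
    (hβ : ∀ n, 0 ≤ 2 * β n + (m n : ℝ) * (μ n + ν n))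
    (hT0 : IsHurwitzStable (T 0)) :
    (∀ n, IsHurwitzStable (T n)) ∧
      (IsSymmetricPoly (T 0) → 0 < (T 0).leadingCoeff → ∀ n, IsSemiGammaPositive (T n)) := by
  have hstep : ∀ n, T (n + 1) = recStep (β n) (μ n) (ν n) (T n) := fun n => by
    rw [hrec, recStep, hdeg]
  have hne' : ∀ n, T (n + 1) ≠ 0 := fun n h => by
    have := hdeg (n + 1)
    rw [h, hgrow] at this
    simp at this
  -- The degree growth excludes the zero polynomial at every index.
  have hne : T 0 ≠ 0 := fun h => hne' 0 (by rw [hrec, h]; simp)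
  have hst : ∀ n, ∀ z : ℂ, 0 < z.re → aeval z (T n) ≠ 0 := by
    intro n
    induction n with
    | zero => exact hT0.resolve_left hne
    | succ n ih =>
      rw [hstep]
      refine recStep_stable (hμ n) (hν n) (hμν n) ?_ ?_ ih
      · rw [hdeg]
        exact hβ n
      · rw [← hstep]
        exact hne' n
  refine ⟨fun n => Or.inr (hst n), fun hsym hlead => ?_⟩
  have hinv : ∀ n, SelfReciprocal (m n) (T n) ∧ 0 < (T n).eval 1 := by
    intro n
    induction n with
    | zero =>
      refine ⟨?_, eval_one_pos_of_stable (hst 0) hlead⟩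
      rw [← hdeg]
      exact hsym.selfReciprocal
    | succ n ih =>
      obtain ⟨h1, h2⟩ := ih
      refine ⟨?_, lt_of_le_of_ne ?_ fun h => ?_⟩
      · rw [hgrow, hstep, ← hdeg]
        exact SelfReciprocal.recStep (by rwa [hdeg])
      -- The cubic vanishes at `1`, so the derivative drops out; strict positivity then comes from
      -- stability at `z = 1`.
      · have h3 : (T (n + 1)).eval 1
            = ((2 * β n + m n * (μ n + ν n)) + 2 * (m n * -μ n)) * (T n).eval 1 := by
          rw [hrec]
          simp [-mul_eq_mul_right_iff]
          ring
        rw [h3]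
        have h4 := mul_nonneg (Nat.cast_nonneg (α := ℝ) (m n)) (neg_nonneg.2 (hμ n))
        have h5 := hβ n
        positivity
      · refine hst (n + 1) 1 (by simp) ?_
        have h3 := aeval_algebraMap_apply ℂ (1 : ℝ) (T (n + 1))
        rw [map_one] at h3
        rw [h3, coe_aeval_eq_eval, ← h, map_zero]
  exact fun n => (hinv n).1.isSemiGammaPositive (hst n) (hinv n).2
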